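/- For $\alpha,\beta>0$ let $p_{\alpha,\beta}$ be the Pareto density on $\mathbb R$, $p_{\alpha,\beta}(x)=\beta\alpha^\beta/x^{\beta+1}$ for $x\ge\alpha$ and $p_{\alpha,\beta}(x)=0$ for $x<\alpha$. Let $P=\{p_{\alpha,\beta}\mid \alpha,\beta>0\}$, a smooth manifold with global coordinates $\theta=(\theta^1,\theta^2)=(\alpha,\beta)\in(0,\infty)^2$, equipped with the Fisher–Rao metric \[ g=\sum_{i,j=1}^2 g_{ij}\,\mathrm d\theta^i\otimes \mathrm d\theta^j,\qquad g_{ij}(\theta)=\int_{\mathbb R} \frac{\partial \log p_\theta(x)}{\partial\theta^i}\,\frac{\partial \log p_\theta(x)}{\partial\theta^j}\,p_\theta(x)\,\mathrm dx \] (the integrand is taken to be $0$ where $p_\theta(x)=0$). Let $H=\{(x,y)\in\mathbb R^2\mid y>0\}$ carry the Poincaré metric $h=(\mathrm dx\otimes\mathrm dx+\mathrm dy\otimes\mathrm dy)/y^2$. The geodesic distance between two points of a Riemannian manifold is the infimum of the lengths of $C^1$ paths joining them; denote it by $d$ on $(P,g)$ and by $d_H$ on $(H,h)$. Then the integrals $g_{ij}(\theta)$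 converge absolutely, and the map $F:P\to H$, $F(p_{\alpha,\beta})=(\log\alpha,1/\beta)$, is a smooth diffeomorphism with $F^*h=g$. For all $\alpha_0,\beta_0,\alpha_1,\beta_1>0$, \[ d(p_{\alpha_0,\beta_0},p_{\alpha_1,\beta_1})=d_H\bigl(F(p_{\alpha_0,\beta_0}),F(p_{\alpha_1,\beta_1})\bigr)=\operatorname{arcosh}\left(1+\frac{\beta_0\beta_1(\log\alpha_0-\log\alpha_1)^2}{2}+\frac{(\beta_0-\beta_1)^2}{2\beta_0\beta_1}\right). \] -/

import Mathlib

open Set Topology MeasureTheory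
open scoped Manifold ContDiff ENNReal UpperHalfPlane

noncomputable section

/-! ### The Fisher–Rao matrix of a parametric family -/

/-- The integrand `∂ᵢ l(x | θ) · ∂ⱼ l(x | θ) · p(x | θ)` of the `(i, j)` entry of the Fisher–Rao
matrix, where `l = log p` and `∂ᵢ` is the partial derivative in the `i`-th parameter. -/
def fisherRaoIntegrand {m : ℕ} (p : EuclideanSpace ℝ (Fin m) → ℝ → ℝ)
    (θ : EuclideanSpace ℝ (Fin m)) (i j : Fin m) (x : ℝ) : ℝ :=
  lineDeriv ℝ (fun η => Real.log (p η x)) θ (EuclideanSpace.single i 1) *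
    lineDeriv ℝ (fun η => Real.log (p η x)) θ (EuclideanSpace.single j 1) * p θ x

/-- The Fisher–Rao matrix `gᵢⱼ(θ) = E[∂ᵢ l(X | θ) ∂ⱼ l(X | θ)]`. -/
def fisherRaoMatrix {m : ℕ} (p : EuclideanSpace ℝ (Fin m) → ℝ → ℝ)
    (θ : EuclideanSpace ℝ (Fin m)) : Matrix (Fin m) (Fin m) ℝ :=
  Matrix.of fun i j => ∫ x, fisherRaoIntegrand p θ i j x

/-! ### The manifold of Pareto densities -/

/-- The density `p(x | α, β) = β α ^ β / x ^ (β + 1)` for `x ≥ α` and `0` for `x < α`, as a function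
of the parameter vector `θ = (α, β)`. -/
def paretoDensity (θ : EuclideanSpace ℝ (Fin 2)) : ℝ → ℝ :=
  ProbabilityTheory.paretoPDFReal (θ 0) (θ 1)

/-- The open parameter space `α > 0`, `β > 0`. -/
def paretoParams : Set (EuclideanSpace ℝ (Fin 2)) := {θ | 0 < θ 0 ∧ 0 < θ 1}

/-- The set `P = {p_{α, β} | α > 0, β > 0}` of all Pareto densities. It is a type of its own, so
that it does not inherit the topology of pointwise convergence. -/
def ParetoFamily : Type := {f : ℝ → ℝ // ∃ θ ∈ paretoParams, paretoDensity θ = f}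

/-- The element `p_{α, β}` of the Pareto family. -/
def pareto (α β : ℝ) (hα : 0 < α) (hβ : 0 < β) : ParetoFamily :=
  ⟨paretoDensity !₂[α, β], !₂[α, β], by simpa [paretoParams] using ⟨hα, hβ⟩, rfl⟩

/-- Different parameters give different Pareto densities. -/
theorem injOn_paretoDensity : InjOn paretoDensity paretoParams := by
  have key : ∀ θ ∈ paretoParams, ∀ η ∈ paretoParams, paretoDensity θ = paretoDensity η →
      η 0 ≤ θ 0 := by
    intro θ hθ η hη h
    by_contra hlt
    have h1 := ProbabilityTheory.paretoPDFReal_pos hθ.1 hθ.2 le_rfl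
    have h2 := congrFun h (θ 0)
    simp only [paretoDensity] at h2
    rw [h2, ProbabilityTheory.paretoPDFReal, if_neg hlt] at h1
    exact lt_irrefl _ h1
  have val : ∀ a b : ℝ, 0 < a → ProbabilityTheory.paretoPDFReal a b a = b / a := by
    intro a b ha
    rw [ProbabilityTheory.paretoPDFReal, if_pos le_rfl, mul_assoc, ← Real.rpow_add ha]
    rw [show b + -(b + 1) = -1 by ring, Real.rpow_neg_one, div_eq_mul_inv]
  intro θ hθ η hη h
  have h0 : θ 0 = η 0 := le_antisymm (key η hη θ hθ h.symm) (key θ hθ η hη h)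
  have h1 : θ 1 = η 1 := by
    have h2 := congrFun h (θ 0)
    simp only [paretoDensity] at h2
    rw [val _ _ hθ.1, h0, val _ _ hη.1] at h2
    exact (div_left_inj' hη.1.ne').1 h2
  ext i
  fin_cases i
  · exact h0
  · exact h1

namespace ParetoFamily

/-- The global coordinates `p_{α, β} ↦ (α, β)`. -/
def coords (p : ParetoFamily) : EuclideanSpace ℝ (Fin 2) := p.2.choose

theorem coords_mem (p : ParetoFamily) : p.coords ∈ paretoParams := p.2.choose_spec.1

theorem paretoDensity_coords (p : ParetoFamily) : paretoDensity p.coords = p.1 :=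
  p.2.choose_spec.2

theorem coords_injective : Function.Injective coords := fun p q h =>
  Subtype.ext (by rw [← paretoDensity_coords p, h, paretoDensity_coords q])

theorem range_coords : range coords = paretoParams := by
  refine Subset.antisymm (range_subset_iff.2 coords_mem) fun θ hθ => ?_
  exact ⟨⟨paretoDensity θ, θ, hθ, rfl⟩,
    injOn_paretoDensity (coords_mem _) hθ (paretoDensity_coords _)⟩

theorem coords_pareto (α β : ℝ) (hα : 0 < α) (hβ : 0 < β) :
    (pareto α β hα hβ).coords = !₂[α, β] :=
  injOn_paretoDensity (coords_mem _) (by simpa [paretoParams] using ⟨hα, hβ⟩)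
    (paretoDensity_coords _)

/-- The topology of the Pareto family is that of its parameter space. -/
instance : TopologicalSpace ParetoFamily := TopologicalSpace.induced coords inferInstance

theorem isOpenEmbedding_coords : IsOpenEmbedding coords where
  eq_induced := rfl
  injective := coords_injective
  isOpen_range := by
    rw [range_coords]
    have h (i : Fin 2) : Continuous fun θ : EuclideanSpace ℝ (Fin 2) => θ i := by fun_prop
    exact (isOpen_lt continuous_const (h 0)).inter (isOpen_lt continuous_const (h 1))

instance : Nonempty ParetoFamily := ⟨pareto 1 1 one_pos one_pos⟩

/-- The smooth structure of the Pareto family, with the single chart `(α, β)`. -/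
instance : ChartedSpace (EuclideanSpace ℝ (Fin 2)) ParetoFamily :=
  isOpenEmbedding_coords.singletonChartedSpace

instance : IsManifold 𝓘(ℝ, EuclideanSpace ℝ (Fin 2)) ∞ ParetoFamily :=
  isOpenEmbedding_coords.isManifold_singleton

end ParetoFamily

/-- The components of a tangent vector in the frame `∂/∂α, ∂/∂β` of the global chart. -/
def ParetoFamily.tangentCoords {p : ParetoFamily}
    (v : TangentSpace 𝓘(ℝ, EuclideanSpace ℝ (Fin 2)) p) : EuclideanSpace ℝ (Fin 2) := v

/-- The Fisher–Rao metric `g = ∑ᵢⱼ gᵢⱼ dθⁱ ⊗ dθʲ` on the manifold of Pareto densities. -/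
def fisherRaoForm (p : ParetoFamily)
    (v w : TangentSpace 𝓘(ℝ, EuclideanSpace ℝ (Fin 2)) p) : ℝ :=
  ∑ i, ∑ j, fisherRaoMatrix paretoDensity p.coords i j *
    ParetoFamily.tangentCoords v i * ParetoFamily.tangentCoords w j

/-! ### The Poincaré upper half-plane -/

/-- The components of a tangent vector of the upper half-plane, as the complex number
`dx(v) + i dy(v)`. -/
def halfPlaneTangentCoords {z : ℍ} (v : TangentSpace 𝓘(ℝ, ℂ) z) : ℂ := v

/-- The Poincaré metric `h = (dx ⊗ dx + dy ⊗ dy) / y ^ 2`. -/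
def poincareForm (z : ℍ) (v w : TangentSpace 𝓘(ℝ, ℂ) z) : ℝ :=
  ((halfPlaneTangentCoords v).re * (halfPlaneTangentCoords w).re +
    (halfPlaneTangentCoords v).im * (halfPlaneTangentCoords w).im) / z.im ^ 2

/-! ### Geodesic distance -/

/-- The geodesic distance of a Riemannian metric `g`: the infimum of the lengths of `C¹` paths
from `x` to `y`, where the length of a path is the integral of `√(g(γ', γ'))`. -/
def geodesicEDist {E H M : Type*} [NormedAddCommGroup E] [NormedSpace ℝ E] [TopologicalSpace H]
    (I : ModelWithCorners ℝ E H) [TopologicalSpace M] [ChartedSpace H M]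
    (g : ∀ x : M, TangentSpace I x → TangentSpace I x → ℝ) (x y : M) : ℝ≥0∞ :=
  letI : ∀ x : M, ENorm (TangentSpace I x) := fun x => ⟨fun v => ENNReal.ofReal √(g x v v)⟩
  Manifold.riemannianEDist I x y

end

/-!
If `X` has density `p_{α, β}`, then `U = log (X / α)` is exponential with rate `β`, and the
components `β / α` and `1 / β - U` of the score are affine in `U`. As `U` has mean `1 / β` and
variance `1 / β ^ 2`, the Fisher–Rao matrix is `diag ((β / α) ^ 2, 1 / β ^ 2)`, which is the
pullback of the Poincaré metric under `(α, β) ↦ log α + i / β`.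

For the Poincaré metric, `z ↦ log (im z)` does not increase lengths and is isometric along vertical
lines, so vertical segments are shortest paths. Möbius transformations are isometries, and one of
them moves any two given points onto a vertical line; hence the geodesic distance is the hyperbolic
distance, whose `cosh` has a closed formula.
-/

noncomputable section

/-! ### Manifolds whose charts are given by an open embedding -/

section SingletonChart

variable {𝕜 E M : Type*} [NontriviallyNormedField 𝕜] [NormedAddCommGroup E] [NormedSpace 𝕜 E]
  [TopologicalSpace M] [Nonempty M] {e : M → E}

theorem hasMFDerivAt_isOpenEmbedding (he : IsOpenEmbedding e) (x : M) :
    letI := he.singletonChartedSpace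
    HasMFDerivAt 𝓘(𝕜, E) 𝓘(𝕜, E) e x (ContinuousLinearMap.id 𝕜 E) := by
  let := he.singletonChartedSpace
  refine ⟨he.continuous.continuousAt, ?_⟩
  have hx : extChartAt 𝓘(𝕜, E) x x = e x := by simp [mfld_simps]
  have hid : writtenInExtChartAt 𝓘(𝕜, E) 𝓘(𝕜, E) x e =ᶠ[𝓝 (e x)] id := by
    filter_upwards [he.isOpen_range.mem_nhds (mem_range_self x)] with y hy
    exact he.toOpenPartialHomeomorph_right_inv e hy
  rw [hx]
  exact ((hasFDerivAt_id (𝕜 := 𝕜) (e x)).congr_of_eventuallyEq hid).hasFDerivWithinAt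

variable {E' H' N : Type*} [NormedAddCommGroup E'] [NormedSpace 𝕜 E'] [TopologicalSpace H']
  {I : ModelWithCorners 𝕜 E' H'} [TopologicalSpace N] [ChartedSpace H' N]

theorem hasMFDerivAt_of_comp_isOpenEmbedding (he : IsOpenEmbedding e) {f : N → M} {x : N}
    {f' : TangentSpace I x →L[𝕜] E} (h : HasMFDerivAt I 𝓘(𝕜, E) (e ∘ f) x f') :
    letI := he.singletonChartedSpace
    HasMFDerivAt I 𝓘(𝕜, E) f x f' :=
  ⟨he.isInducing.continuousAt_iff.2 h.1, h.2⟩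

end SingletonChart

/-! ### Geodesic distances -/

section GeodesicEDist

variable {E H M E' H' M' : Type*} [NormedAddCommGroup E] [NormedSpace ℝ E] [TopologicalSpace H]
  {I : ModelWithCorners ℝ E H} [TopologicalSpace M] [ChartedSpace H M]
  [NormedAddCommGroup E'] [NormedSpace ℝ E'] [TopologicalSpace H']
  {J : ModelWithCorners ℝ E' H'} [TopologicalSpace M'] [ChartedSpace H' M']
  {g : ∀ x : M, TangentSpace I x → TangentSpace I x → ℝ}
  {h : ∀ y : M', TangentSpace J y → TangentSpace J y → ℝ}

theorem geodesicEDist_eq_iInf (g : ∀ x : M, TangentSpace I x → TangentSpace I x → ℝ) (x y : M) :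
    geodesicEDist I g x y = ⨅ (γ : Path x y) (_ : ContMDiff (𝓡∂ 1) I 1 γ),
      ∫⁻ t, ENNReal.ofReal √(g (γ t) (mfderiv (𝓡∂ 1) I γ t 1) (mfderiv (𝓡∂ 1) I γ t 1)) := by
  rw [geodesicEDist, Manifold.riemannianEDist]
  rfl

theorem geodesicEDist_map_le {F : M → M'} (hF : ContMDiff I J 1 F)
    (hle : ∀ x (v : TangentSpace I x), h (F x) (mfderiv I J F x v) (mfderiv I J F x v) ≤ g x v v)
    (x y : M) : geodesicEDist J h (F x) (F y) ≤ geodesicEDist I g x y := by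
  rw [geodesicEDist_eq_iInf, geodesicEDist_eq_iInf]
  refine le_iInf₂ fun γ hγ => ?_
  refine (iInf₂_le (γ.map hF.continuous) (hF.comp hγ)).trans (lintegral_mono fun t => ?_)
  have hchain : mfderiv (𝓡∂ 1) J (γ.map hF.continuous) t =
      (mfderiv I J F (γ t)).comp (mfderiv (𝓡∂ 1) I γ t) :=
    mfderiv_comp t (hF.mdifferentiableAt one_ne_zero) (hγ.mdifferentiableAt one_ne_zero)
  rw [hchain]
  exact ENNReal.ofReal_le_ofReal (Real.sqrt_le_sqrt (hle _ _))

theorem geodesicEDist_diffeomorph {n : ℕ∞ω} (hn : 1 ≤ n) (F : M ≃ₘ^n⟮I, J⟯ M')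
    (hF : ∀ x (v : TangentSpace I x), h (F x) (mfderiv I J F x v) (mfderiv I J F x v) = g x v v)
    (x y : M) : geodesicEDist J h (F x) (F y) = geodesicEDist I g x y := by
  refine le_antisymm (geodesicEDist_map_le (F.contMDiff.of_le hn) (fun x v => (hF x v).le) x y) ?_
  have hid (G : M' → M') (hG : G = id) (z : M') (v : TangentSpace J z) :
      h (G z) (mfderiv J J G z v) (mfderiv J J G z v) = h z v v := by
    subst hG
    rw [mfderiv_id]
    rfl
  have hsymm (z : M') (v : TangentSpace J z) :
      g (F.symm z) (mfderiv J I F.symm z v) (mfderiv J I F.symm z v) = h z v v := by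
    have hn0 : n ≠ 0 := (one_pos.trans_le hn).ne'
    rw [← hF, ← hid (F ∘ F.symm) (funext F.apply_symm_apply) z v,
      mfderiv_comp z (F.mdifferentiable hn0 _) (F.symm.mdifferentiable hn0 _)]
    rfl
  simpa using geodesicEDist_map_le (F.symm.contMDiff.of_le hn) (fun z v => (hsymm z v).le)
    (F x) (F y)

variable {V : Type*} [NormedAddCommGroup V] [InnerProductSpace ℝ V]

/-- The Euclidean metric of an inner product space, every tangent space being identified with the
space itself. -/
def euclideanForm (x : V) (v w : TangentSpace 𝓘(ℝ, V) x) : ℝ :=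
  inner ℝ (show V from v) (show V from w)

theorem geodesicEDist_euclideanForm (x y : V) :
    geodesicEDist 𝓘(ℝ, V) euclideanForm x y = edist x y := by
  rw [IsRiemannianManifold.out (I := 𝓘(ℝ, V)) x y, geodesicEDist]
  congr 1
  funext z
  refine congrArg ENorm.mk (funext fun v => ?_)
  have hnorm (v : V) : ENNReal.ofReal √(inner ℝ v v) = ‖v‖ₑ := by
    rw [← norm_eq_sqrt_real_inner, ofReal_norm]
  exact (hnorm v).trans (enorm_tangentSpace_vectorSpace (v := v)).symm

end GeodesicEDist

/-! ### The Poincaré half-plane -/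

section PoincareHalfPlane

open UpperHalfPlane
open scoped MatrixGroups

theorem poincareForm_self (z : ℍ) (v : TangentSpace 𝓘(ℝ, ℂ) z) :
    poincareForm z v v = (‖halfPlaneTangentCoords v‖ / z.im) ^ 2 := by
  rw [poincareForm, div_pow, Complex.sq_norm, Complex.normSq_apply]

/-- The vertical half-line with real part `x`, parametrized by hyperbolic arc length. -/
def verticalLine (x s : ℝ) : ℍ := ⟨⟨x, Real.exp s⟩, Real.exp_pos s⟩

theorem verticalLine_log_im (z : ℍ) : verticalLine z.re (Real.log z.im) = z :=
  UpperHalfPlane.ext (Complex.ext rfl (Real.exp_log z.im_pos))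

theorem contMDiff_verticalLine (x : ℝ) {n : ℕ∞ω} :
    ContMDiff 𝓘(ℝ, ℝ) 𝓘(ℝ, ℂ) n (verticalLine x) :=
  .of_comp_isOpenEmbedding isOpenEmbedding_coe
    (Complex.equivRealProdCLM.symm.contDiff.comp
      (contDiff_const.prodMk Real.contDiff_exp)).contMDiff

theorem hasMFDerivAt_verticalLine (x s : ℝ) :
    HasMFDerivAt 𝓘(ℝ, ℝ) 𝓘(ℝ, ℂ) (verticalLine x) s
      (ContinuousLinearMap.toSpanSingleton ℝ (⟨0, Real.exp s⟩ : ℂ)) := by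
  have hd : HasDerivAt (fun s => (verticalLine x s : ℂ)) ⟨0, Real.exp s⟩ s :=
    Complex.equivRealProdCLM.symm.hasFDerivAt.comp_hasDerivAt s
      ((hasDerivAt_const s x).prodMk (Real.hasDerivAt_exp s))
  exact hasMFDerivAt_of_comp_isOpenEmbedding isOpenEmbedding_coe hd.hasFDerivAt.hasMFDerivAt

theorem geodesicEDist_verticalLine_le (x s t : ℝ) :
    geodesicEDist 𝓘(ℝ, ℂ) poincareForm (verticalLine x s) (verticalLine x t) ≤ edist s t := by
  rw [← geodesicEDist_euclideanForm]
  refine geodesicEDist_map_le (contMDiff_verticalLine x) (fun u v => le_of_eq ?_) s t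
  have hunit (v : ℝ) : (‖v • (⟨0, Real.exp u⟩ : ℂ)‖ / Real.exp u) ^ 2 = v * v := by
    have hnorm : ‖(⟨0, Real.exp u⟩ : ℂ)‖ = Real.exp u := by
      rw [← Complex.abs_im_eq_norm.2 rfl, Real.abs_exp]
    rw [norm_smul, hnorm, mul_div_cancel_right₀ _ (Real.exp_ne_zero u), Real.norm_eq_abs, sq_abs,
      sq]
  rw [poincareForm_self, (hasMFDerivAt_verticalLine x u).mfderiv]
  exact hunit v

theorem edist_log_im_le_geodesicEDist (z w : ℍ) :
    edist (Real.log z.im) (Real.log w.im) ≤ geodesicEDist 𝓘(ℝ, ℂ) poincareForm z w := by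
  have hC : ContMDiff 𝓘(ℝ, ℂ) 𝓘(ℝ, ℝ) 1 fun p : ℍ => Real.log p.im := fun p =>
    (Complex.imCLM.contDiff.contDiffAt.log p.im_ne_zero).contMDiffAt.comp p
      (contMDiff_isOpenEmbedding isOpenEmbedding_coe).contMDiffAt
  rw [← geodesicEDist_euclideanForm]
  refine geodesicEDist_map_le hC (fun p v => ?_) z w
  have hd : HasMFDerivAt 𝓘(ℝ, ℂ) 𝓘(ℝ, ℝ) (fun p : ℍ => Real.log p.im) p
      ((p.im⁻¹ • Complex.imCLM).comp (ContinuousLinearMap.id ℝ ℂ)) :=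
    HasMFDerivAt.comp p (Complex.imCLM.hasFDerivAt.log p.im_ne_zero).hasMFDerivAt
      (hasMFDerivAt_isOpenEmbedding isOpenEmbedding_coe p)
  have hgrad (v : ℂ) : p.im⁻¹ * v.im * (p.im⁻¹ * v.im) ≤ (‖v‖ / p.im) ^ 2 := by
    rw [← sq, inv_mul_eq_div, sq_le_sq, abs_div, abs_div, abs_norm]
    gcongr
    exact Complex.abs_im_le_norm v
  rw [poincareForm_self, hd.mfderiv]
  exact hgrad v

theorem geodesicEDist_poincareForm_of_re_eq {z w : ℍ} (h : z.re = w.re) :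
    geodesicEDist 𝓘(ℝ, ℂ) poincareForm z w = edist z w := by
  have hlog : edist z w = edist (Real.log z.im) (Real.log w.im) := by
    rw [edist_dist, edist_dist, dist_of_re_eq h]
  rw [hlog]
  refine le_antisymm ?_ (edist_log_im_le_geodesicEDist z w)
  have hvert := geodesicEDist_verticalLine_le z.re (Real.log z.im) (Real.log w.im)
  rwa [verticalLine_log_im, h, verticalLine_log_im] at hvert

theorem contMDiff_specialLinearGroup_smul (g : SL(2, ℝ)) {n : ℕ∞ω} :
    ContMDiff 𝓘(ℝ, ℂ) 𝓘(ℝ, ℂ) n (fun z : ℍ => g • z) := by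
  refine .of_comp_isOpenEmbedding isOpenEmbedding_coe fun z => ?_
  have hC : ContDiffAt ℝ n (fun p : ℂ => (↑(g • ofComplex p) : ℂ)) z :=
    (analyticAt_smul (g := g) (by simp) z).contDiffAt.restrict_scalars ℝ
  refine (hC.contMDiffAt.comp z
    (contMDiff_isOpenEmbedding isOpenEmbedding_coe).contMDiffAt).congr_of_eventuallyEq
    (.of_forall fun p => ?_)
  simp only [Function.comp_apply, ofComplex_apply]

theorem hasMFDerivAt_specialLinearGroup_smul (g : SL(2, ℝ)) (z : ℍ) :
    HasMFDerivAt 𝓘(ℝ, ℂ) 𝓘(ℝ, ℂ) (fun z : ℍ => g • z) z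
      ((ContinuousLinearMap.toSpanSingleton ℂ
        (1 / denom g z ^ 2) : ℂ →L[ℂ] ℂ).restrictScalars ℝ) := by
  have hd : HasDerivAt (fun p : ℂ => (↑(g • ofComplex p) : ℂ)) (1 / denom g z ^ 2) z := by
    refine (hasStrictDerivAt_smul (g := g) (by simp) z).hasDerivAt.congr_deriv ?_
    simp
  refine hasMFDerivAt_of_comp_isOpenEmbedding isOpenEmbedding_coe ?_
  have hcomp := HasMFDerivAt.comp z (hd.hasFDerivAt.restrictScalars ℝ).hasMFDerivAt
    (hasMFDerivAt_isOpenEmbedding isOpenEmbedding_coe z)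
  refine hcomp.congr_of_eventuallyEq (.of_forall fun p => ?_)
  simp only [Function.comp_apply, ofComplex_apply]

theorem im_specialLinearGroup_smul (g : SL(2, ℝ)) (z : ℍ) :
    (g • z).im = z.im / ‖denom g z‖ ^ 2 := by
  refine (im_smul_eq_div_normSq (g : GL (Fin 2) ℝ) z).trans ?_
  simp [Complex.sq_norm]

theorem poincareForm_mfderiv_specialLinearGroup_smul (g : SL(2, ℝ)) (z : ℍ)
    (v : TangentSpace 𝓘(ℝ, ℂ) z) :
    poincareForm (g • z) (mfderiv 𝓘(ℝ, ℂ) 𝓘(ℝ, ℂ) (fun z : ℍ => g • z) z v)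
      (mfderiv 𝓘(ℝ, ℂ) 𝓘(ℝ, ℂ) (fun z : ℍ => g • z) z v) = poincareForm z v v := by
  have hd : denom g z ≠ 0 := denom_ne_zero _ z
  have hnorm (v : ℂ) : (‖v • (1 / denom g z ^ 2)‖ / (z.im / ‖denom g z‖ ^ 2)) ^ 2 =
      (‖v‖ / z.im) ^ 2 := by
    rw [norm_smul, norm_div, norm_one, norm_pow]
    field_simp
  rw [poincareForm_self, poincareForm_self, im_specialLinearGroup_smul,
    (hasMFDerivAt_specialLinearGroup_smul g z).mfderiv]
  exact hnorm v

theorem geodesicEDist_specialLinearGroup_smul (g : SL(2, ℝ)) (z w : ℍ) :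
    geodesicEDist 𝓘(ℝ, ℂ) poincareForm (g • z) (g • w) =
      geodesicEDist 𝓘(ℝ, ℂ) poincareForm z w := by
  have hle (g : SL(2, ℝ)) (z w : ℍ) : geodesicEDist 𝓘(ℝ, ℂ) poincareForm (g • z) (g • w) ≤
      geodesicEDist 𝓘(ℝ, ℂ) poincareForm z w :=
    geodesicEDist_map_le (contMDiff_specialLinearGroup_smul g)
      (fun p v => (poincareForm_mfderiv_specialLinearGroup_smul g p v).le) z w
  refine le_antisymm (hle g z w) ?_
  simpa using hle g⁻¹ (g • z) (g • w)

theorem exists_specialLinearGroup_smul_re_eq (z w : ℍ) :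
    ∃ g : SL(2, ℝ), (g • z).re = (g • w).re := by
  by_cases h : z.re = w.re
  · exact ⟨1, by simpa using h⟩
  -- The geodesic through `z` and `w` is a half-circle centred at `c` on the real axis;
  -- `p ↦ -1 / (p - a)` sends its end point `a` to infinity.
  obtain ⟨c, hc⟩ : ∃ c, (z.re - c) ^ 2 + z.im ^ 2 = (w.re - c) ^ 2 + w.im ^ 2 := by
    have h0 : z.re - w.re ≠ 0 := sub_ne_zero.2 h
    exact ⟨(z.re ^ 2 + z.im ^ 2 - w.re ^ 2 - w.im ^ 2) / (2 * (z.re - w.re)), by field_simp; ring⟩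
  obtain ⟨a, ha⟩ : ∃ a, (c - a) ^ 2 = (z.re - c) ^ 2 + z.im ^ 2 :=
    ⟨c - √((z.re - c) ^ 2 + z.im ^ 2), by rw [sub_sub_cancel, Real.sq_sqrt (by positivity)]⟩
  let g : SL(2, ℝ) := ⟨!![0, -1; 1, -a], by simp [Matrix.det_fin_two]⟩
  have hre (p : ℍ) (hp : (c - a) ^ 2 = (p.re - c) ^ 2 + p.im ^ 2) :
      (g • p).re = -1 / (2 * (c - a)) := by
    have hsq : 0 < (p.re - a) ^ 2 + p.im ^ 2 := by
      have := p.im_pos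
      positivity
    have hcoe : (↑(g • p) : ℂ) = -1 / (p - a) := by
      rw [coe_specialLinearGroup_apply]
      simp [g, sub_eq_add_neg]
    have hchord : (p.re - a) ^ 2 + p.im ^ 2 = 2 * (c - a) * (p.re - a) := by
      linear_combination -hp
    have hdiv : (-1 / ((p : ℂ) - a)).re = -(p.re - a) / ((p.re - a) ^ 2 + p.im ^ 2) := by
      simp [Complex.div_re, Complex.normSq_apply, sq]
    rw [← coe_re, hcoe, hdiv]
    have hpos : 0 < 2 * (c - a) * (p.re - a) := hchord ▸ hsq
    have hca : c - a ≠ 0 := fun h0 => by simp [h0] at hpos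
    have hpa : p.re - a ≠ 0 := fun h0 => by simp [h0] at hpos
    rw [hchord]
    field_simp
  exact ⟨g, (hre z ha).trans (hre w (ha.trans hc)).symm⟩

theorem geodesicEDist_poincareForm (z w : ℍ) :
    geodesicEDist 𝓘(ℝ, ℂ) poincareForm z w = edist z w := by
  obtain ⟨g, hg⟩ := exists_specialLinearGroup_smul_re_eq z w
  rw [← geodesicEDist_specialLinearGroup_smul g, geodesicEDist_poincareForm_of_re_eq hg,
    edist_smul_left]

theorem edist_eq_ofReal_arcosh (z w : ℍ) :
    edist z w = ENNReal.ofReal (Real.arcosh (1 + dist (z : ℂ) w ^ 2 / (2 * z.im * w.im))) := by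
  rw [← cosh_dist, Real.arcosh_cosh dist_nonneg, edist_dist]

end PoincareHalfPlane

/-! ### The Fisher–Rao matrix of the Pareto family -/

section FisherRao

open ProbabilityTheory

theorem log_paretoPDFReal {α β x : ℝ} (hα : 0 < α) (hβ : 0 < β) (hx : α ≤ x) :
    Real.log (paretoPDFReal α β x) =
      Real.log β - Real.log x - β * (Real.log x - Real.log α) := by
  have hx0 : 0 < x := hα.trans_le hx
  rw [paretoPDFReal, if_pos hx, Real.log_mul (by positivity) (by positivity),
    Real.log_mul hβ.ne' (by positivity), Real.log_rpow hα, Real.log_rpow hx0]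
  ring

theorem paretoPDFReal_mul_exp {α β u : ℝ} (hα : 0 < α) (hu : 0 ≤ u) :
    α * Real.exp u * paretoPDFReal α β (α * Real.exp u) = β * Real.exp (-(β * u)) := by
  have hle : α ≤ α * Real.exp u := le_mul_of_one_le_right hα.le (Real.one_le_exp hu)
  rw [paretoPDFReal, if_pos hle, Real.mul_rpow hα.le (Real.exp_pos u).le, ← Real.exp_mul]
  have hα1 : α * (α ^ β * α ^ (-(β + 1))) = 1 := by
    rw [← Real.rpow_add hα, show β + -(β + 1) = -1 by ring, Real.rpow_neg_one,
      mul_inv_cancel₀ hα.ne']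
  have hexp : Real.exp u * Real.exp (u * -(β + 1)) = Real.exp (-(β * u)) := by
    rw [← Real.exp_add]
    ring_nf
  linear_combination β * Real.exp u * Real.exp (u * -(β + 1)) * hα1 + β * hexp

section LogTransform

variable {α β : ℝ}

theorem image_mul_exp_Ioi (hα : 0 < α) : (fun u => α * Real.exp u) '' Ioi 0 = Ioi α := by
  ext x
  constructor
  · rintro ⟨u, hu, rfl⟩
    exact lt_mul_of_one_lt_right hα (Real.one_lt_exp_iff.2 hu)
  · intro hx
    have hx1 : 1 < x / α := (one_lt_div hα).2 hx
    refine ⟨Real.log (x / α), Real.log_pos hx1, ?_⟩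
    simp only [Real.exp_log (one_pos.trans hx1)]
    field_simp

theorem monotone_mul_exp (hα : 0 < α) : Monotone fun u => α * Real.exp u :=
  Real.exp_monotone.const_mul hα.le

theorem hasDerivAt_mul_exp (α u : ℝ) : HasDerivAt (fun u => α * Real.exp u) (α * Real.exp u) u :=
  (Real.hasDerivAt_exp u).const_mul α

theorem eqOn_mul_exp_smul_paretoPDFReal (hα : 0 < α) (f : ℝ → ℝ) :
    EqOn (fun u => (α * Real.exp u) • (f (Real.log (α * Real.exp u / α)) *
        paretoPDFReal α β (α * Real.exp u)))
      (fun u => f u * (β * Real.exp (-(β * u)))) (Ioi 0) := by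
  intro u hu
  have hlog : Real.log (α * Real.exp u / α) = u := by
    rw [mul_div_cancel_left₀ _ hα.ne', Real.log_exp]
  simp only [smul_eq_mul]
  rw [hlog, mul_left_comm, paretoPDFReal_mul_exp hα hu.le]

theorem integrableOn_comp_log_mul_paretoPDFReal_iff (hα : 0 < α) (f : ℝ → ℝ) :
    IntegrableOn (fun x => f (Real.log (x / α)) * paretoPDFReal α β x) (Ioi α) ↔
      IntegrableOn (fun u => f u * (β * Real.exp (-(β * u)))) (Ioi 0) := by
  rw [← image_mul_exp_Ioi hα, integrableOn_image_iff_integrableOn_deriv_smul_of_monotoneOn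
    measurableSet_Ioi (fun u _ => (hasDerivAt_mul_exp α u).hasDerivWithinAt)
    ((monotone_mul_exp hα).monotoneOn _)]
  exact integrableOn_congr_fun (eqOn_mul_exp_smul_paretoPDFReal hα f) measurableSet_Ioi

theorem integral_comp_log_mul_paretoPDFReal (hα : 0 < α) (f : ℝ → ℝ) :
    ∫ x in Ioi α, f (Real.log (x / α)) * paretoPDFReal α β x =
      ∫ u in Ioi 0, f u * (β * Real.exp (-(β * u))) := by
  rw [← image_mul_exp_Ioi hα, integral_image_eq_integral_deriv_smul_of_monotoneOn
    measurableSet_Ioi (fun u _ => (hasDerivAt_mul_exp α u).hasDerivWithinAt)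
    ((monotone_mul_exp hα).monotoneOn _)]
  exact setIntegral_congr_fun measurableSet_Ioi (eqOn_mul_exp_smul_paretoPDFReal hα f)

end LogTransform

section ExponentialMoments

variable {r : ℝ}

theorem integrableOn_pow_mul_exp_Ioi (hr : 0 < r) (n : ℕ) :
    IntegrableOn (fun u => u ^ n * (r * Real.exp (-(r * u)))) (Ioi 0) := by
  have h := integrableOn_rpow_mul_exp_neg_mul_rpow (p := 1) (s := n) (b := r)
    (by linarith [n.cast_nonneg (α := ℝ)]) one_pos hr
  refine IntegrableOn.congr_fun (h.const_mul r) (fun u _ => ?_) measurableSet_Ioi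
  simp only [Real.rpow_natCast, Real.rpow_one]
  ring_nf

theorem integral_pow_mul_exp_Ioi (hr : 0 < r) (n : ℕ) :
    ∫ u in Ioi 0, u ^ n * (r * Real.exp (-(r * u))) = n.factorial / r ^ n := by
  have h := Real.integral_rpow_mul_exp_neg_mul_Ioi (a := n + 1) (by positivity) hr
  simp only [add_sub_cancel_right, Real.rpow_natCast, Real.Gamma_nat_eq_factorial] at h
  simp only [mul_left_comm _ r]
  rw [integral_const_mul, h, ← Nat.cast_add_one, Real.rpow_natCast, one_div, inv_pow, pow_succ]
  field_simp

theorem integrableOn_affine_mul_affine_mul_exp_Ioi (hr : 0 < r) (a b c d : ℝ) :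
    IntegrableOn (fun u => (a + b * u) * (c + d * u) * (r * Real.exp (-(r * u)))) (Ioi 0) := by
  have h := integrableOn_pow_mul_exp_Ioi hr
  refine IntegrableOn.congr_fun ((((h 0).const_mul (a * c)).add
    ((h 1).const_mul (a * d + b * c))).add ((h 2).const_mul (b * d))) (fun u _ => ?_)
    measurableSet_Ioi
  simp only [Pi.add_apply]
  ring

/-- For `U` exponential with rate `r`, the product of the means of `a + b U` and `c + d U` plus
their covariance. -/
theorem integral_affine_mul_affine_mul_exp_Ioi (hr : 0 < r) (a b c d : ℝ) :
    ∫ u in Ioi 0, (a + b * u) * (c + d * u) * (r * Real.exp (-(r * u))) =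
      (a + b / r) * (c + d / r) + b * d / r ^ 2 := by
  have h := integrableOn_pow_mul_exp_Ioi hr
  have hexpand (u : ℝ) : (a + b * u) * (c + d * u) * (r * Real.exp (-(r * u))) =
      a * c * (u ^ 0 * (r * Real.exp (-(r * u)))) +
        (a * d + b * c) * (u ^ 1 * (r * Real.exp (-(r * u)))) +
        b * d * (u ^ 2 * (r * Real.exp (-(r * u)))) := by
    ring
  simp only [hexpand]
  rw [integral_add (((h 0).const_mul _).fun_add ((h 1).const_mul _)) ((h 2).const_mul _),
    integral_add ((h 0).const_mul _) ((h 1).const_mul _), integral_const_mul, integral_const_mul,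
    integral_const_mul]
  simp only [integral_pow_mul_exp_Ioi hr, Nat.factorial]
  field_simp
  push_cast
  ring

end ExponentialMoments

/-- The components of the score of the Pareto family at an observation `x`, as affine functions
of `u = log (x / α)`: `∂l/∂α = β / α` and `∂l/∂β = 1 / β - u`. -/
def paretoScore (θ : EuclideanSpace ℝ (Fin 2)) (i : Fin 2) (u : ℝ) : ℝ :=
  ![θ 1 / θ 0, 1 / θ 1] i + ![0, -1] i * u

variable {θ : EuclideanSpace ℝ (Fin 2)}

theorem hasFDerivAt_log_paretoDensity (hθ : θ ∈ paretoParams) {x : ℝ} (hx : θ 0 < x) :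
    HasFDerivAt (fun η => Real.log (paretoDensity η x))
      ((θ 1 / θ 0) • EuclideanSpace.proj (𝕜 := ℝ) (0 : Fin 2) +
        (1 / θ 1 - Real.log (x / θ 0)) • EuclideanSpace.proj (𝕜 := ℝ) (1 : Fin 2)) θ := by
  have hproj (i : Fin 2) : HasFDerivAt (fun η : EuclideanSpace ℝ (Fin 2) => η i)
      (EuclideanSpace.proj (𝕜 := ℝ) i) θ := (EuclideanSpace.proj (𝕜 := ℝ) i).hasFDerivAt
  have hev : (fun η => Real.log (paretoDensity η x)) =ᶠ[𝓝 θ] fun η =>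
      Real.log (η 1) - Real.log x - η 1 * (Real.log x - Real.log (η 0)) := by
    filter_upwards [(hproj 0).continuousAt.eventually (lt_mem_nhds hθ.1),
      (hproj 0).continuousAt.eventually (gt_mem_nhds hx),
      (hproj 1).continuousAt.eventually (lt_mem_nhds hθ.2)] with η h0 hlt h1
    exact log_paretoPDFReal h0 h1 hlt.le
  refine HasFDerivAt.congr_of_eventuallyEq ?_ hev
  refine ((((hproj 1).log hθ.2.ne').sub_const (Real.log x)).sub
    ((hproj 1).mul (((hproj 0).log hθ.1.ne').const_sub (Real.log x)))).congr_fderiv ?_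
  ext v
  rw [Real.log_div (hθ.1.trans hx).ne' hθ.1.ne']
  simp only [smul_neg, sub_apply, smul_apply, PiLp.proj_apply, smul_eq_mul, add_apply, neg_apply,
    one_div]
  ring

theorem lineDeriv_log_paretoDensity (hθ : θ ∈ paretoParams) {x : ℝ} (hx : θ 0 < x) (i : Fin 2) :
    lineDeriv ℝ (fun η => Real.log (paretoDensity η x)) θ (EuclideanSpace.single i 1) =
      paretoScore θ i (Real.log (x / θ 0)) := by
  rw [(hasFDerivAt_log_paretoDensity hθ hx).hasLineDerivAt _ |>.lineDeriv]
  fin_cases i <;> simp [paretoScore, sub_eq_add_neg]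

theorem fisherRaoIntegrand_paretoDensity_ae_eq (hθ : θ ∈ paretoParams) (i j : Fin 2) :
    fisherRaoIntegrand paretoDensity θ i j =ᵐ[volume] (Ioi (θ 0)).indicator fun x =>
      paretoScore θ i (Real.log (x / θ 0)) * paretoScore θ j (Real.log (x / θ 0)) *
        paretoPDFReal (θ 0) (θ 1) x := by
  filter_upwards [Measure.ae_ne volume (θ 0)] with x hx
  rcases hx.lt_or_gt with hlt | hgt
  · rw [indicator_of_notMem (notMem_Ioi.2 hlt.le), fisherRaoIntegrand, paretoDensity,
      paretoPDFReal, if_neg hlt.not_ge, mul_zero]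
  · rw [indicator_of_mem (mem_Ioi.2 hgt), fisherRaoIntegrand, lineDeriv_log_paretoDensity hθ hgt,
      lineDeriv_log_paretoDensity hθ hgt, paretoDensity]

theorem integrable_fisherRaoIntegrand_paretoDensity (hθ : θ ∈ paretoParams) (i j : Fin 2) :
    Integrable (fisherRaoIntegrand paretoDensity θ i j) := by
  rw [integrable_congr (fisherRaoIntegrand_paretoDensity_ae_eq hθ i j),
    integrable_indicator_iff measurableSet_Ioi,
    integrableOn_comp_log_mul_paretoPDFReal_iff hθ.1 fun u => paretoScore θ i u * paretoScore θ j u]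
  exact integrableOn_affine_mul_affine_mul_exp_Ioi hθ.2 _ _ _ _

theorem fisherRaoMatrix_paretoDensity (hθ : θ ∈ paretoParams) :
    fisherRaoMatrix paretoDensity θ = !![(θ 1 / θ 0) ^ 2, 0; 0, 1 / θ 1 ^ 2] := by
  ext i j
  rw [fisherRaoMatrix, Matrix.of_apply,
    integral_congr_ae (fisherRaoIntegrand_paretoDensity_ae_eq hθ i j),
    integral_indicator measurableSet_Ioi,
    integral_comp_log_mul_paretoPDFReal hθ.1 fun u => paretoScore θ i u * paretoScore θ j u]
  simp only [paretoScore]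
  have hmean (k : Fin 2) : ![θ 1 / θ 0, 1 / θ 1] k + ![0, -1] k / θ 1 = ![θ 1 / θ 0, 0] k := by
    fin_cases k <;> simp [neg_div]
  rw [integral_affine_mul_affine_mul_exp_Ioi hθ.2, hmean, hmean]
  fin_cases i <;> fin_cases j <;> simp [sq]

end FisherRao

/-! ### The isometry onto the half-plane -/

namespace ParetoFamily

/-- The map `F` in the coordinates `θ = (α, β)`, namely `θ ↦ log α + i / β`. -/
def coordsToComplex (θ : EuclideanSpace ℝ (Fin 2)) : ℂ := ⟨Real.log (θ 0), (θ 1)⁻¹⟩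

/-- The differential of `coordsToComplex` at `θ`, namely `dα / α - i dβ / β ^ 2`. -/
def coordsToComplexDeriv (θ : EuclideanSpace ℝ (Fin 2)) : EuclideanSpace ℝ (Fin 2) →L[ℝ] ℂ :=
  Complex.equivRealProdCLM.symm.toContinuousLinearMap.comp
    (((θ 0)⁻¹ • EuclideanSpace.proj (𝕜 := ℝ) (0 : Fin 2)).prod
      ((-(θ 1 ^ 2)⁻¹) • EuclideanSpace.proj (𝕜 := ℝ) (1 : Fin 2)))

theorem contDiffAt_coordsToComplex {θ : EuclideanSpace ℝ (Fin 2)} (hθ : θ ∈ paretoParams)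
    {n : ℕ∞ω} : ContDiffAt ℝ n coordsToComplex θ := by
  have hproj (i : Fin 2) : ContDiffAt ℝ n (fun η : EuclideanSpace ℝ (Fin 2) => η i) θ :=
    (EuclideanSpace.proj (𝕜 := ℝ) i).contDiff.contDiffAt
  exact Complex.equivRealProdCLM.symm.contDiff.contDiffAt.comp θ
    (((hproj 0).log hθ.1.ne').prodMk ((hproj 1).inv hθ.2.ne'))

theorem hasFDerivAt_coordsToComplex {θ : EuclideanSpace ℝ (Fin 2)} (hθ : θ ∈ paretoParams) :
    HasFDerivAt coordsToComplex (coordsToComplexDeriv θ) θ := by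
  have hproj (i : Fin 2) : HasFDerivAt (fun η : EuclideanSpace ℝ (Fin 2) => η i)
      (EuclideanSpace.proj (𝕜 := ℝ) i) θ := (EuclideanSpace.proj (𝕜 := ℝ) i).hasFDerivAt
  exact Complex.equivRealProdCLM.symm.hasFDerivAt.comp θ
    (((hproj 0).log hθ.1.ne').prodMk
      ((hasDerivAt_inv hθ.2.ne').comp_hasFDerivAt θ (hproj 1)))

/-- The diffeomorphism `p_{α, β} ↦ log α + i / β` of the Pareto family onto the half-plane. -/
def toHalfPlane :
    ParetoFamily ≃ₘ^∞⟮𝓘(ℝ, EuclideanSpace ℝ (Fin 2)), 𝓘(ℝ, ℂ)⟯ ℍ where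
  toFun p := ⟨coordsToComplex p.coords, inv_pos.2 p.coords_mem.2⟩
  invFun z := pareto (Real.exp z.re) z.im⁻¹ (Real.exp_pos _) (inv_pos.2 z.im_pos)
  left_inv p := by
    apply coords_injective
    rw [coords_pareto]
    ext i
    fin_cases i
    · exact Real.exp_log p.coords_mem.1
    · exact inv_inv _
  right_inv z := by
    refine UpperHalfPlane.ext (Complex.ext ?_ ?_) <;> simp [coords_pareto, coordsToComplex]
  contMDiff_toFun := .of_comp_isOpenEmbedding UpperHalfPlane.isOpenEmbedding_coe fun p =>
    (contDiffAt_coordsToComplex p.coords_mem).contMDiffAt.comp p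
      (contMDiff_isOpenEmbedding isOpenEmbedding_coords).contMDiffAt
  contMDiff_invFun := by
    refine .of_comp_isOpenEmbedding isOpenEmbedding_coords fun z => ?_
    have hC : ContDiffAt ℝ ∞ (fun w : ℂ => !₂[Real.exp w.re, w.im⁻¹]) (z : ℂ) := by
      refine contDiffAt_euclidean.2 fun i => ?_
      fin_cases i
      · exact Complex.reCLM.contDiff.contDiffAt.exp
      · exact Complex.imCLM.contDiff.contDiffAt.inv z.im_pos.ne'
    refine (hC.contMDiffAt.comp z
      (contMDiff_isOpenEmbedding UpperHalfPlane.isOpenEmbedding_coe).contMDiffAt)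
      |>.congr_of_eventuallyEq (.of_forall fun w => ?_)
    exact coords_pareto _ _ (Real.exp_pos _) (inv_pos.2 w.im_pos)

theorem toHalfPlane_re (p : ParetoFamily) : (toHalfPlane p).re = Real.log (p.coords 0) := rfl

theorem toHalfPlane_im (p : ParetoFamily) : (toHalfPlane p).im = (p.coords 1)⁻¹ := rfl

theorem hasMFDerivAt_toHalfPlane (p : ParetoFamily) :
    HasMFDerivAt 𝓘(ℝ, EuclideanSpace ℝ (Fin 2)) 𝓘(ℝ, ℂ) toHalfPlane p
      (coordsToComplexDeriv p.coords) :=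
  hasMFDerivAt_of_comp_isOpenEmbedding UpperHalfPlane.isOpenEmbedding_coe
    ((hasFDerivAt_coordsToComplex p.coords_mem).hasMFDerivAt.comp p
      (hasMFDerivAt_isOpenEmbedding isOpenEmbedding_coords p))

theorem fisherRaoForm_eq (p : ParetoFamily)
    (v w : TangentSpace 𝓘(ℝ, EuclideanSpace ℝ (Fin 2)) p) :
    fisherRaoForm p v w =
      (p.coords 1 / p.coords 0) ^ 2 * tangentCoords v 0 * tangentCoords w 0 +
        1 / p.coords 1 ^ 2 * tangentCoords v 1 * tangentCoords w 1 := by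
  rw [fisherRaoForm, fisherRaoMatrix_paretoDensity p.coords_mem]
  simp [Fin.sum_univ_two]

theorem poincareForm_mfderiv_toHalfPlane (p : ParetoFamily)
    (v w : TangentSpace 𝓘(ℝ, EuclideanSpace ℝ (Fin 2)) p) :
    poincareForm (toHalfPlane p)
        (mfderiv 𝓘(ℝ, EuclideanSpace ℝ (Fin 2)) 𝓘(ℝ, ℂ) toHalfPlane p v)
        (mfderiv 𝓘(ℝ, EuclideanSpace ℝ (Fin 2)) 𝓘(ℝ, ℂ) toHalfPlane p w) =
      fisherRaoForm p v w := by
  have h0 : p.coords 0 ≠ 0 := p.coords_mem.1.ne'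
  have h1 : p.coords 1 ≠ 0 := p.coords_mem.2.ne'
  have hcoords (u : TangentSpace 𝓘(ℝ, EuclideanSpace ℝ (Fin 2)) p) :
      halfPlaneTangentCoords
          (mfderiv 𝓘(ℝ, EuclideanSpace ℝ (Fin 2)) 𝓘(ℝ, ℂ) toHalfPlane p u) =
        ⟨(p.coords 0)⁻¹ * tangentCoords u 0, -(p.coords 1 ^ 2)⁻¹ * tangentCoords u 1⟩ := by
    rw [(hasMFDerivAt_toHalfPlane p).mfderiv]
    rfl
  rw [fisherRaoForm_eq, poincareForm, hcoords, hcoords, toHalfPlane_im]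
  field_simp

theorem geodesicEDist_toHalfPlane (p q : ParetoFamily) :
    geodesicEDist 𝓘(ℝ, ℂ) poincareForm (toHalfPlane p) (toHalfPlane q) =
      geodesicEDist 𝓘(ℝ, EuclideanSpace ℝ (Fin 2)) fisherRaoForm p q :=
  geodesicEDist_diffeomorph (by simp) toHalfPlane
    (fun p v => poincareForm_mfderiv_toHalfPlane p v v) p q

end ParetoFamily

end

theorem mainTheorem4 :
    (∀ α β : ℝ, 0 < α → 0 < β → ∀ i j : Fin 2,
      Integrable (fisherRaoIntegrand paretoDensity !₂[α, β] i j)) ∧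
    ∃ F : ParetoFamily ≃ₘ^∞⟮𝓘(ℝ, EuclideanSpace ℝ (Fin 2)), 𝓘(ℝ, ℂ)⟯ ℍ,
      (∀ (α β : ℝ) (hα : 0 < α) (hβ : 0 < β),
        (F (pareto α β hα hβ)).re = Real.log α ∧ (F (pareto α β hα hβ)).im = 1 / β) ∧
      (∀ (p : ParetoFamily) (v w : TangentSpace 𝓘(ℝ, EuclideanSpace ℝ (Fin 2)) p),
        poincareForm (F p)
            (mfderiv 𝓘(ℝ, EuclideanSpace ℝ (Fin 2)) 𝓘(ℝ, ℂ) F p v)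
            (mfderiv 𝓘(ℝ, EuclideanSpace ℝ (Fin 2)) 𝓘(ℝ, ℂ) F p w) =
          fisherRaoForm p v w) ∧
      ∀ (α₀ β₀ α₁ β₁ : ℝ) (hα₀ : 0 < α₀) (hβ₀ : 0 < β₀) (hα₁ : 0 < α₁) (hβ₁ : 0 < β₁),
        geodesicEDist 𝓘(ℝ, EuclideanSpace ℝ (Fin 2)) fisherRaoForm
            (pareto α₀ β₀ hα₀ hβ₀) (pareto α₁ β₁ hα₁ hβ₁) =
          geodesicEDist 𝓘(ℝ, ℂ) poincareForm
            (F (pareto α₀ β₀ hα₀ hβ₀)) (F (pareto α₁ β₁ hα₁ hβ₁)) ∧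
        geodesicEDist 𝓘(ℝ, EuclideanSpace ℝ (Fin 2)) fisherRaoForm
            (pareto α₀ β₀ hα₀ hβ₀) (pareto α₁ β₁ hα₁ hβ₁) =
          ENNReal.ofReal (Real.arcosh (1 + β₀ * β₁ * (Real.log α₀ - Real.log α₁) ^ 2 / 2 +
            (β₀ - β₁) ^ 2 / (2 * β₀ * β₁))) := by
  refine ⟨fun α β hα hβ => integrable_fisherRaoIntegrand_paretoDensity ⟨hα, hβ⟩,
    ParetoFamily.toHalfPlane, fun α β hα hβ => ?_,
    ParetoFamily.poincareForm_mfderiv_toHalfPlane, fun α₀ β₀ α₁ β₁ hα₀ hβ₀ hα₁ hβ₁ => ?_⟩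
  · simp [ParetoFamily.toHalfPlane_re, ParetoFamily.toHalfPlane_im, ParetoFamily.coords_pareto]
  · refine ⟨(ParetoFamily.geodesicEDist_toHalfPlane _ _).symm, ?_⟩
    rw [← ParetoFamily.geodesicEDist_toHalfPlane, geodesicEDist_poincareForm,
      edist_eq_ofReal_arcosh, Complex.dist_eq, Complex.sq_norm, Complex.normSq_apply]
    simp only [Complex.sub_re, Complex.sub_im, UpperHalfPlane.coe_re, UpperHalfPlane.coe_im,
      ParetoFamily.toHalfPlane_re, ParetoFamily.toHalfPlane_im,
      ParetoFamily.coords_pareto, PiLp.toLp_apply, Matrix.cons_val_zero, Matrix.cons_val_one]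
    congr 2
    field_simp
    ring
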